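/- A pseudo-arc is a nondegenerate compact connected metrizable space $\Psi$ that is chainable (every open cover is refined by a finite open cover $U_0,\dots,U_{k-1}$ such that $U_i\cap U_j\neq\emptyset$ if and only if $|i-j|\le 1$) and hereditarily indecomposable (no nonempty closed connected subset, i.e. subcontinuum, is the union of two proper subcontinua); it is unique up to homeomorphism. A chain with $n$ links in $\Psi$ is a tuple $\overline a=(a_0,\dots,a_{n-1})$ of pairwise distinct regular closed subsets of $\Psi$ (sets equal to the closure of their interior) such that $\bigcup_{i<n}a_i=\Psi$; the interior of $a_i\cap a_j$ is empty whenever $i\neq j$; no $a_i$ is contained in $a_j$ for $j\neq i$; and $a_i\cap a_j\neq\emptyset$ implies $|i-j|\le 1$. A pattern $f\colon m\twoheadrightarrow n$ is a surjection from $\{0,\dots,m-1\}$ onto $\{0,\dots,n-1\}$ such that $|i-j|\le 1$ implies $|f(i)-f(j)|\le 1$. Let $\Psi$ be the pseudo-arc. For every chain $\overline a$ with $n$ links in $\Psi$ and every pattern $f\colon m\twoheadrightarrow n$, there is a chain $\overline b=(b_0,\dots,b_{m-1})$ with $m$ links in $\Psi$ that follows $f$ in $\overline a$, that is, $b_j\subseteq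 a_{f(j)}$ for every $j<m$. -/

import Mathlib

open Set

namespace PseudoArcCologic

/-! Continua and the pseudo-arc -/

section Continua

variable {X : Type*} [TopologicalSpace X]

/-- A subcontinuum: a nonempty closed connected subset (of a compact space).
`IsConnected` includes nonemptiness. -/
def IsSubcontinuum (C : Set X) : Prop :=
  IsClosed C ∧ IsConnected C

/-- A subcontinuum `C` is indecomposable if it is not the union of two subcontinua both
different from `C`. -/
def IsIndecomposable (C : Set X) : Prop :=
  ∀ A B : Set X, IsSubcontinuum A → IsSubcontinuum B → A ∪ B = C → A = C ∨ B = C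

variable (X)

/-- Every subcontinuum is indecomposable. -/
def IsHereditarilyIndecomposable : Prop :=
  ∀ C : Set X, IsSubcontinuum C → IsIndecomposable C

/-- Chainability (arc-likeness): every open cover is refined by a finite open cover
`U 0, …, U (k - 1)` in which two links meet exactly when their indices differ by at most one.
For a compact metrizable space this says that for every `ε > 0` there is such a cover whose
links have diameter less than `ε`. -/
def IsChainable : Prop :=
  ∀ 𝒰 : Set (Set X), (∀ V ∈ 𝒰, IsOpen V) → ⋃₀ 𝒰 = univ →
    ∃ (k : ℕ) (U : Fin k → Set X),
      (∀ i, IsOpen (U i)) ∧ (⋃ i, U i) = univ ∧ (∀ i, ∃ V ∈ 𝒰, U i ⊆ V) ∧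
      ∀ i j : Fin k, (U i ∩ U j).Nonempty ↔ |((i : ℕ) : ℤ) - ((j : ℕ) : ℤ)| ≤ 1

/-- `X` is a pseudo-arc: a nondegenerate, chainable, hereditarily indecomposable metrizable
continuum. (Up to homeomorphism there is exactly one such space.) -/
structure IsPseudoArc : Prop where
  compact : CompactSpace X
  metrizable : TopologicalSpace.MetrizableSpace X
  connected : ConnectedSpace X
  nondegenerate : Nontrivial X
  chainable : IsChainable X
  hereditarilyIndecomposable : IsHereditarilyIndecomposable X

end Continua

/-! The contact algebra of regular closed sets: its order is inclusion, its join is union,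
its bottom and top elements are `∅` and `univ`. -/

section RegularClosed

variable {X : Type*} [TopologicalSpace X]

/-- A regular closed set is the closure of its interior. -/
def IsRegularClosed (F : Set X) : Prop :=
  closure (interior F) = F

/-- The meet of two regular closed sets in the Boolean algebra of regular closed sets. -/
def regMeet (F G : Set X) : Set X :=
  closure (interior (F ∩ G))

/-- The proximity (contact) relation on regular closed sets. -/
def Touches (F G : Set X) : Prop :=
  (F ∩ G).Nonempty

/-- A good tuple of length `n`: a non-repeating enumeration of a finite minimal cover of `X` by
regular closed sets that merely touch. -/
structure IsGoodTuple {n : ℕ} (a : Fin n → Set X) : Prop where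
  nonrepeating : Function.Injective a
  regularClosed : ∀ i, IsRegularClosed (a i)
  cover : (⋃ i, a i) = univ
  merelyTouch : ∀ i j, a i ≠ a j → regMeet (a i) (a j) = ∅
  minimal : ∀ i j, a i ⊆ a j → a i = a j

/-- A chain with `n` links: a good tuple only whose equal or consecutive entries touch. -/
structure IsLinkChain {n : ℕ} (a : Fin n → Set X) : Prop where
  good : IsGoodTuple a
  chain : ∀ i j : Fin n, Touches (a i) (a j) → |((i : ℕ) : ℤ) - ((j : ℕ) : ℤ)| ≤ 1

/-- `b` follows the arrangement `f` in `a`. -/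
def Follows {m n : ℕ} (b : Fin m → Set X) (f : Fin m → Fin n) (a : Fin n → Set X) : Prop :=
  ∀ j, b j ⊆ a (f j)

end RegularClosed

/-- A pattern `f : m ↠ n`: a surjection that moves neighbouring indices to equal or neighbouring
indices. -/
structure IsPattern {m n : ℕ} (f : Fin m → Fin n) : Prop where
  surjective : Function.Surjective f
  step : ∀ i j : Fin m, |((i : ℕ) : ℤ) - ((j : ℕ) : ℤ)| ≤ 1 →
    |((f i : ℕ) : ℤ) - ((f j : ℕ) : ℤ)| ≤ 1

end PseudoArcCologic

namespace PseudoArcCologic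

/-! Read the pattern as a walk `F` on the links of the given chain and induct on its length. If `F`
stalls, delete the repeated step, follow the shorter walk, and cut one link in two
(`IsNatChain.exists_split`). If `F` has neither stalls nor turning points, surjectivity makes it the
identity or the reversal, and the chain itself or its reverse works.

Otherwise take a shortest run between consecutive turning points or ends. Minimality makes `F`
symmetric, over the length of the run, about each end of the run that is a turning point. If both
ends are turning points, `F` is a shorter walk composed with a simple fold (up, down, up). A run at
an end of the walk is handled by following `F` without it, folding, and joining two of the three
legs link by link (`IsNatChain.amalgamate`).

So everything rests on realizing a simple fold, `IsNatChain.exists_simpleFold`. Hereditary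
indecomposability enters only here, through the Krasinkiewicz–Minc property: overlapping subcontinua
are nested, so components of two closed sets that reach outside each other's set are disjoint, and
compactness turns this into disjoint clopen parts. -/

/-- Every step of `g` on `{0, …, M}` moves by at most one. -/
def IsShortStep (M : ℕ) (g : ℕ → ℕ) : Prop :=
  ∀ k < M, g (k + 1) ≤ g k + 1 ∧ g k ≤ g (k + 1) + 1

/-! ### Turning points and shortest runs of integer walks. -/

section Combinatorics

theorem IsShortStep.dist_le {M : ℕ} {g : ℕ → ℕ} (hg : IsShortStep M g) {i j : ℕ} (hij : i ≤ j)
    (hj : j ≤ M) : g j ≤ g i + (j - i) ∧ g i ≤ g j + (j - i) := by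
  induction j, hij using Nat.le_induction with
  | base => simp
  | succ j hij ih =>
    have := ih (by omega)
    have := hg j (by omega)
    omega

variable {F : ℕ → ℕ} {M : ℕ}

/-- A walk without stalls is symmetric about a turning point as long as it meets no other turning
point. -/
theorem reflect_of_turning (hF : IsShortStep M F) (hs : ∀ k < M, F k ≠ F (k + 1)) {t l : ℕ}
    (hlt : l ≤ t) (htl : t + l ≤ M) (ht : F (t - 1) = F (t + 1))
    (hno : ∀ u, t - l < u → u < t + l → u ≠ t → F (u - 1) ≠ F (u + 1)) :
    ∀ k ≤ l, F (t + k) = F (t - k) := by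
  -- Away from turning points a walk without stalls has vanishing second difference, so both sides
  -- of `t` obey the same recursion with the same initial values.
  have lin : ∀ u, t - l < u → u < t + l → u ≠ t → F (u + 1) + F (u - 1) = 2 * F u := by
    intro u h1 h2 h3
    have a1 := hF u (by omega)
    have a2 := hF (u - 1) (by omega)
    have a3 := hs u (by omega)
    have a4 := hs (u - 1) (by omega)
    have a5 := hno u h1 h2 h3
    rw [show u - 1 + 1 = u by omega] at a2 a4
    omega
  intro k
  induction k using Nat.strong_induction_on with
  | _ k ih =>
    intro hk
    match k with
    | 0 => simp
    | 1 => exact ht.symm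
    | k + 2 =>
      have h1 := ih (k + 1) (by omega) (by omega)
      have h0 := ih k (by omega) (by omega)
      have b1 := lin (t + (k + 1)) (by omega) (by omega) (by omega)
      have b2 := lin (t - (k + 1)) (by omega) (by omega) (by omega)
      rw [show t + (k + 1) + 1 = t + (k + 2) by omega,
        show t + (k + 1) - 1 = t + k by omega] at b1
      rw [show t - (k + 1) + 1 = t - k by omega,
        show t - (k + 1) - 1 = t - (k + 2) by omega] at b2
      omega

/-- A walk with neither stalls nor turning points is monotone of slope `1` or `-1`. -/
theorem linear_of_no_turning (hF : IsShortStep M F) (hs : ∀ k < M, F k ≠ F (k + 1))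
    (hno : ∀ u, 0 < u → u < M → F (u - 1) ≠ F (u + 1)) :
    (∀ k ≤ M, F k = F 0 + k) ∨ (∀ k ≤ M, F k + k = F 0) := by
  have lin : ∀ u, u + 1 < M → F (u + 2) + F u = 2 * F (u + 1) := by
    intro u h
    have a1 := hF (u + 1) (by omega)
    have a2 := hF u (by omega)
    have a3 := hs (u + 1) (by omega)
    have a4 := hs u (by omega)
    have a5 := hno (u + 1) (by omega) (by omega)
    simp only [Nat.add_sub_cancel, add_assoc, Nat.reduceAdd] at a1 a3 a5
    omega
  rcases Nat.eq_zero_or_pos M with rfl | hM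
  · left
    intro k hk
    obtain rfl : k = 0 := by omega
    rfl
  have h0 := hF 0 hM
  have h1 := hs 0 hM
  have key : ∀ k, k < M → (F (k + 1) : ℤ) - F k = F 1 - F 0 := by
    intro k
    induction k with
    | zero => simp
    | succ k ih =>
      intro hk
      have := ih (by omega)
      have := lin k hk
      rw [show k + 1 + 1 = k + 2 by omega]
      omega
  rcases (show F 1 = F 0 + 1 ∨ F 1 + 1 = F 0 by simp only [zero_add] at h0 h1; omega) with h | h
  · left
    intro k
    induction k with
    | zero => simp
    | succ k ih =>
      intro hk
      have := ih (by omega)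
      have := key k (by omega)
      omega
  · right
    intro k
    induction k with
    | zero => simp
    | succ k ih =>
      intro hk
      have := ih (by omega)
      have := key k (by omega)
      omega

/-- A shortest stretch between turning points or ends, the stretch being `{s, …, s + l}`: the walk
is symmetric about each of its ends that is a turning point. -/
theorem exists_shortest_run (hF : IsShortStep M F) (hs : ∀ k < M, F k ≠ F (k + 1))
    (ht : ∃ u, 0 < u ∧ u < M ∧ F (u - 1) = F (u + 1)) :
    ∃ s l, 0 < l ∧ l < M ∧ s + l ≤ M ∧
      (0 < s → l ≤ s ∧ ∀ k ≤ l, F (s + k) = F (s - k)) ∧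
      (s + l < M → s + l + l ≤ M ∧ ∀ k ≤ l, F (s + l + k) = F (s + l - k)) := by
  classical
  -- The ends count as turning points here, so that the first and last runs also compete for minimal
  -- length.
  let E : ℕ → Prop := fun t => t = 0 ∨ t = M ∨ (0 < t ∧ t < M ∧ F (t - 1) = F (t + 1))
  have hex : ∃ l, 0 < l ∧ l < M ∧ ∃ s, s + l ≤ M ∧ E s ∧ E (s + l) := by
    obtain ⟨u, h0, h1, h2⟩ := ht
    exact ⟨u, h0, h1, 0, by omega, Or.inl rfl, Or.inr (Or.inr (by simpa using ⟨h0, h1, h2⟩))⟩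
  -- By minimality no two points of `E` are closer than `l`: the reflection window of radius `l`
  -- about a turning end of the run stays inside the walk and contains no other turning point in its
  -- interior.
  obtain ⟨l, ⟨hl, hlM, s, hsl, hEs, hEt⟩, hmin⟩ :
      ∃ l, (0 < l ∧ l < M ∧ ∃ s, s + l ≤ M ∧ E s ∧ E (s + l)) ∧
        ∀ x y, x < y → y ≤ M → y < x + l → E x → E y → False := by
    refine ⟨Nat.find hex, Nat.find_spec hex, fun x y hxy hy hl hx hy' => ?_⟩
    have h := (Nat.find_spec hex).2.1
    refine Nat.find_min hex (m := y - x) (by omega) ⟨by omega, by omega, x, by omega, hx, ?_⟩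
    rwa [show x + (y - x) = y by omega]
  have hE0 : E 0 := Or.inl rfl
  have hEM : E M := Or.inr (Or.inl rfl)
  refine ⟨s, l, hl, hlM, hsl, fun h0 => ?_, fun h1 => ?_⟩
  · have hls : l ≤ s := by
      by_contra h
      exact hmin 0 s h0 (by omega) (by omega) hE0 hEs
    refine ⟨hls, reflect_of_turning hF hs hls hsl (by rcases hEs with h | h | h <;> omega) fun u hu1 hu2 hu3 hu => ?_⟩
    have hEu : E u := Or.inr (Or.inr ⟨by omega, by omega, hu⟩)
    rcases lt_or_gt_of_ne hu3 with h | h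
    · exact hmin u s h (by omega) (by omega) hEu hEs
    · exact hmin s u h (by omega) (by omega) hEs hEu
  · have hls : s + l + l ≤ M := by
      by_contra h
      exact hmin (s + l) M h1 le_rfl (by omega) hEt hEM
    refine ⟨hls, reflect_of_turning hF hs (by omega) hls (by rcases hEt with h | h | h <;> omega)
      fun u hu1 hu2 hu3 hu => ?_⟩
    have hEu : E u := Or.inr (Or.inr ⟨by omega, by omega, hu⟩)
    rcases lt_or_gt_of_ne hu3 with h | h
    · exact hmin u (s + l) h (by omega) (by omega) hEu hEt
    · exact hmin (s + l) u h (by omega) (by omega) hEt hEu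

/-- The simple fold that goes up from `0` to `q`, down to `p` and up again. -/
def simpleFold (p q x : ℕ) : ℕ :=
  if x ≤ q then x else if x ≤ 2 * q - p then 2 * q - x else x - 2 * (q - p)

end Combinatorics

/-! ### Regular closed sets and chains indexed by the natural numbers. -/

section Topology

variable {X : Type*} [TopologicalSpace X]

theorem IsRegularClosed.isClosed {F : Set X} (h : IsRegularClosed F) : IsClosed F := by
  rw [← h]; exact isClosed_closure

theorem IsRegularClosed.interior_nonempty {F : Set X} (h : IsRegularClosed F) (hF : F.Nonempty) :
    (interior F).Nonempty := by
  rw [← h] at hF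
  exact closure_nonempty_iff.1 hF

theorem isRegularClosed_closure_of_isOpen {U : Set X} (hU : IsOpen U) :
    IsRegularClosed (closure U) :=
  subset_antisymm (closure_minimal interior_subset isClosed_closure)
    (closure_mono (hU.subset_interior_iff.2 subset_closure))

theorem isRegularClosed_biUnion {ι : Type*} {b : ι → Set X} {S : Set ι} (hS : S.Finite)
    (h : ∀ i, IsRegularClosed (b i)) : IsRegularClosed (⋃ i ∈ S, b i) := by
  refine subset_antisymm (closure_minimal interior_subset
    (hS.isClosed_biUnion fun i _ => (h i).isClosed)) (iUnion₂_subset fun i hi => ?_)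
  conv_lhs => rw [← h i]
  exact closure_mono (interior_mono (subset_biUnion_of_mem hi))

/-- A relatively clopen part of a regular closed set is regular closed. -/
theorem IsRegularClosed.inter_of_disjoint {F C D : Set X} (hF : IsRegularClosed F)
    (hC : IsClosed C) (hD : IsClosed D) (hFCD : F ⊆ C ∪ D) (hdis : Disjoint C D) :
    IsRegularClosed (F ∩ C) := by
  refine subset_antisymm (closure_minimal interior_subset (hF.isClosed.inter hC)) ?_
  rintro x ⟨hxF, hxC⟩
  rw [← hF] at hxF
  have hxD : x ∈ Dᶜ := fun h => disjoint_left.1 hdis hxC h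
  have h := hD.isOpen_compl.inter_closure ⟨hxD, hxF⟩
  refine closure_mono ?_ h
  refine (hD.isOpen_compl.inter isOpen_interior).subset_interior_iff.2 ?_
  rintro y ⟨hyD, hyF⟩
  exact ⟨interior_subset hyF, (hFCD (interior_subset hyF)).resolve_right hyD⟩

theorem IsRegularClosed.disjoint_interior {F G : Set X} (hF : IsRegularClosed F)
    (h : interior (F ∩ G) = ∅) : Disjoint (interior G) F := by
  rw [interior_inter] at h
  have h1 : Disjoint (interior G) (interior F) := by
    rw [disjoint_iff_inter_eq_empty, inter_comm]; exact h
  rw [← hF]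
  exact h1.closure_right isOpen_interior

/-- A chain with links `b 0, …, b M`, the other sets being empty. -/
structure IsNatChain (M : ℕ) (b : ℕ → Set X) : Prop where
  regularClosed : ∀ i, IsRegularClosed (b i)
  cover : ∀ x, ∃ i, x ∈ b i
  merelyTouch : ∀ i j, i < j → interior (b i ∩ b j) = ∅
  disjoint : ∀ i j, i + 1 < j → Disjoint (b i) (b j)
  eq_empty : ∀ i, M < i → b i = ∅
  nonempty : ∀ i, i ≤ M → (b i).Nonempty

namespace IsNatChain

variable {M : ℕ} {b : ℕ → Set X}

theorem le_of_mem (h : IsNatChain M b) {i : ℕ} {x : X} (hx : x ∈ b i) : i ≤ M := by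
  by_contra hi
  simp [h.eq_empty i (by omega)] at hx

theorem biUnion_eq (h : IsNatChain M b) (S : Set ℕ) : ⋃ i ∈ S, b i = ⋃ i ∈ S ∩ Iic M, b i := by
  ext x
  simp only [mem_iUnion, exists_prop, mem_inter_iff, mem_Iic]
  exact ⟨fun ⟨i, hi, hx⟩ => ⟨i, ⟨hi, h.le_of_mem hx⟩, hx⟩, fun ⟨i, hi, hx⟩ => ⟨i, hi.1, hx⟩⟩

theorem isRegularClosed_biUnion (h : IsNatChain M b) (S : Set ℕ) :
    IsRegularClosed (⋃ i ∈ S, b i) := by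
  rw [h.biUnion_eq]
  exact PseudoArcCologic.isRegularClosed_biUnion ((finite_Iic M).inter_of_right S)
    h.regularClosed

theorem isClosed_biUnion (h : IsNatChain M b) (S : Set ℕ) : IsClosed (⋃ i ∈ S, b i) :=
  (h.isRegularClosed_biUnion S).isClosed

theorem disjoint_interior (h : IsNatChain M b) {i j : ℕ} (hij : i ≠ j) :
    Disjoint (interior (b i)) (b j) := by
  apply (h.regularClosed j).disjoint_interior
  rcases lt_or_gt_of_ne hij with h1 | h1
  · rw [inter_comm]; exact h.merelyTouch i j h1
  · exact h.merelyTouch j i h1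

theorem disjoint_biUnion (h : IsNatChain M b) {S T : Set ℕ}
    (hST : ∀ i ∈ S, ∀ j ∈ T, i + 1 < j ∨ j + 1 < i) :
    Disjoint (⋃ i ∈ S, b i) (⋃ i ∈ T, b i) := by
  simp only [disjoint_iUnion_left, disjoint_iUnion_right]
  intro i hi j hj
  rcases hST j hj i hi with h1 | h1
  · exact h.disjoint _ _ h1
  · exact (h.disjoint _ _ h1).symm

/-- By connectedness only the end links need a nonemptiness check: if an intermediate link were
empty, the links below it and those above it would be disjoint closed sets covering the space. -/
theorem of_ends [ConnectedSpace X] (hreg : ∀ i, IsRegularClosed (b i))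
    (hcov : ∀ x, ∃ i, x ∈ b i) (htouch : ∀ i j, i < j → interior (b i ∩ b j) = ∅)
    (hdis : ∀ i j, i + 1 < j → Disjoint (b i) (b j)) (hempty : ∀ i, M < i → b i = ∅)
    (h0 : (b 0).Nonempty) (hM : (b M).Nonempty) : IsNatChain M b := by
  refine ⟨hreg, hcov, htouch, hdis, hempty, fun j hj => ?_⟩
  by_contra hne
  rw [not_nonempty_iff_eq_empty] at hne
  have hj0 : 0 < j := by
    rcases Nat.eq_zero_or_pos j with rfl | h
    · simp [hne] at h0
    · exact h
  have hjM : j < M := by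
    rcases hj.eq_or_lt with rfl | h
    · simp [hne] at hM
    · exact h
  have hP : IsClosed (⋃ i ∈ Iio j, b i) :=
    (finite_Iio j).isClosed_biUnion fun i _ => (hreg i).isClosed
  have hQ : IsClosed (⋃ i ∈ Ioc j M, b i) :=
    (finite_Ioc j M).isClosed_biUnion fun i _ => (hreg i).isClosed
  have hPQ : (⋃ i ∈ Iio j, b i) ∪ (⋃ i ∈ Ioc j M, b i) = univ := by
    refine eq_univ_of_forall fun x => ?_
    obtain ⟨i, hi⟩ := hcov x
    rcases lt_trichotomy i j with h | rfl | h
    · exact Or.inl (mem_biUnion (x := i) h hi)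
    · simp [hne] at hi
    · refine Or.inr (mem_biUnion (x := i) ⟨h, ?_⟩ hi)
      by_contra h'
      simp [hempty i (by omega)] at hi
  obtain ⟨x, hx⟩ := h0
  obtain ⟨y, hy⟩ := hM
  obtain ⟨z, -, hzP, hzQ⟩ := isPreconnected_closed_iff.1 (isPreconnected_univ (α := X)) _ _ hP hQ
    hPQ.ge ⟨x, mem_univ _, mem_biUnion (x := 0) hj0 hx⟩
    ⟨y, mem_univ _, mem_biUnion (x := M) ⟨hjM, le_rfl⟩ hy⟩
  simp only [mem_iUnion, mem_Iio, mem_Ioc, exists_prop] at hzP hzQ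
  obtain ⟨i, hi, hzi⟩ := hzP
  obtain ⟨k, hk, hzk⟩ := hzQ
  exact disjoint_left.1 (hdis i k (by omega)) hzi hzk

theorem reverse (h : IsNatChain M b) :
    IsNatChain M fun i => if i ≤ M then b (M - i) else ∅ := by
  have hreg : ∀ i, IsRegularClosed (if i ≤ M then b (M - i) else ∅) := by
    intro i
    split_ifs
    · exact h.regularClosed _
    · simp [IsRegularClosed]
  refine ⟨hreg, fun x => ?_, fun i j hij => ?_, fun i j hij => ?_, fun i hi => ?_, fun i hi => ?_⟩
  · obtain ⟨i, hi⟩ := h.cover x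
    have := h.le_of_mem hi
    refine ⟨M - i, ?_⟩
    rwa [if_pos (by omega), show M - (M - i) = i by omega]
  · by_cases hj : j ≤ M
    · rw [if_pos hj, if_pos (by omega), inter_comm]
      exact h.merelyTouch _ _ (by omega)
    · simp [hj]
  · by_cases hj : j ≤ M
    · rw [if_pos hj, if_pos (by omega)]
      exact (h.disjoint _ _ (by omega)).symm
    · simp [hj]
  · simp [hi]
  · rw [if_pos hi]
    exact h.nonempty _ (by omega)

/-- Joining the links of a chain along a surjective walk gives a chain. -/
theorem amalgamate (h : IsNatChain M b) {K : ℕ} {g : ℕ → ℕ} (hg : IsShortStep M g)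
    (hgK : ∀ i ≤ M, g i ≤ K) (hsurj : ∀ k ≤ K, ∃ i ≤ M, g i = k) :
    IsNatChain K fun k => ⋃ i ∈ g ⁻¹' {k}, b i := by
  -- Values of a short-step walk that differ by at least two come from indices that differ by at
  -- least two.
  have hdisj : ∀ i j, i ≤ M → j ≤ M → g i + 1 < g j → Disjoint (b i) (b j) := by
    intro i j hi hj hij
    rcases le_total i j with hle | hle
    · have := hg.dist_le hle hj
      exact h.disjoint _ _ (by omega)
    · have := hg.dist_le hle hi
      exact (h.disjoint _ _ (by omega)).symm
  refine ⟨fun i => h.isRegularClosed_biUnion _, fun x => ?_, fun k l hkl => ?_, fun k l hkl => ?_,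
    fun k hk => ?_, fun k hk => ?_⟩
  · obtain ⟨i, hi⟩ := h.cover x
    exact ⟨g i, mem_biUnion (x := i) rfl hi⟩
  · by_contra hne
    obtain ⟨x, hx⟩ := nonempty_iff_ne_empty.2 hne
    have hx' := (interior_subset hx).1
    simp only [mem_iUnion, exists_prop] at hx'
    obtain ⟨i, hi, hxi⟩ := hx'
    -- The interior of `b i` accumulates at `x`, so the open set contains an interior point of `b
    -- i`; such a point lies in no other link.
    rw [← h.regularClosed i] at hxi
    obtain ⟨y, hy, hyi⟩ := mem_closure_iff.1 hxi _ isOpen_interior hx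
    have hy' := (interior_subset hy).2
    simp only [mem_iUnion, exists_prop] at hy'
    obtain ⟨j, hj, hyj⟩ := hy'
    refine disjoint_left.1 (h.disjoint_interior (i := i) (j := j) ?_) hyi hyj
    rintro rfl
    simp only [mem_preimage, mem_singleton_iff] at hi hj
    omega
  · simp only [disjoint_iUnion_left, disjoint_iUnion_right]
    intro i hi j hj
    rw [Set.disjoint_left]
    intro x hxj hxi
    simp only [mem_preimage, mem_singleton_iff] at hi hj
    exact disjoint_left.1 (hdisj _ _ (h.le_of_mem hxj) (h.le_of_mem hxi) (by omega)) hxj hxi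
  · rw [eq_empty_iff_forall_notMem]
    intro x hx
    simp only [mem_iUnion, exists_prop, mem_preimage, mem_singleton_iff] at hx
    obtain ⟨i, hi, hx⟩ := hx
    have := hgK i (h.le_of_mem hx)
    omega
  · obtain ⟨i, hi, rfl⟩ := hsurj k hk
    obtain ⟨x, hx⟩ := h.nonempty i hi
    exact ⟨x, mem_biUnion (x := i) rfl hx⟩

end IsNatChain

end Topology
-- Clopen parts of closed sets and the Krasinkiewicz–Minc property.
section Separation

variable {X : Type*} [TopologicalSpace X]

/-- `P` and `P'` are complementary clopen parts of the closed set `L`. -/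
structure IsClopenSplit (L P P' : Set X) : Prop where
  closed_left : IsClosed P
  closed_right : IsClosed P'
  disjoint : Disjoint P P'
  union : P ∪ P' = L

namespace IsClopenSplit

variable {L P P' Q Q' : Set X}

theorem symm (h : IsClopenSplit L P P') : IsClopenSplit L P' P :=
  ⟨h.closed_right, h.closed_left, h.disjoint.symm, by rw [union_comm, h.union]⟩

theorem union_inter (h : IsClopenSplit L P P') (k : IsClopenSplit L Q Q') :
    IsClopenSplit L (P ∪ Q) (P' ∩ Q') := by
  refine ⟨h.closed_left.union k.closed_left, h.closed_right.inter k.closed_right, ?_, ?_⟩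
  · exact disjoint_union_left.2 ⟨h.disjoint.mono_right inter_subset_left,
      k.disjoint.mono_right inter_subset_right⟩
  · ext x
    have h1 := Set.ext_iff.1 h.union x
    have h2 := Set.ext_iff.1 k.union x
    simp only [mem_union, mem_inter_iff] at *
    tauto

/-- Supplies the relative neighbourhoods required by the compactness inductions below. -/
theorem mem_nhdsWithin (h : IsClopenSplit L P P') {A : Set X} (hA : A ⊆ L) {a : X} (ha : a ∈ P) :
    P ∈ nhdsWithin a A := by
  have h1 : P'ᶜ ∈ nhds a := h.closed_right.isOpen_compl.mem_nhds
    fun h' => disjoint_left.1 h.disjoint ha h'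
  refine Filter.mem_of_superset (inter_mem_nhdsWithin A h1) ?_
  rintro x ⟨hxA, hx⟩
  have := hA hxA
  rw [← h.union] at this
  exact this.resolve_right hx

end IsClopenSplit

/-- In a compact Hausdorff space a closed set has arbitrarily small clopen parts around each of its
components. -/
theorem exists_clopenSplit_of_component [CompactSpace X] [T2Space X] {L : Set X}
    (hL : IsClosed L) (a : L) {U : Set X} (hU : IsOpen U)
    (hKU : (↑) '' connectedComponent a ⊆ U) :
    ∃ P P', IsClopenSplit L P P' ∧ (a : X) ∈ P ∧ P ⊆ U := by
  have : CompactSpace L := isCompact_iff_compactSpace.1 hL.isCompact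
  have hV : ∀ x ∈ ⋂ s : { s : Set L // IsClopen s ∧ a ∈ s }, (s : Set L),
      ((↑) : L → X) ⁻¹' U ∈ nhds x := by
    intro x hx
    -- In a compact Hausdorff space components are quasi-components, so a finite intersection of
    -- clopen sets already lies in `U`.
    rw [← connectedComponent_eq_iInter_isClopen] at hx
    exact (hU.preimage continuous_subtype_val).mem_nhds (hKU (mem_image_of_mem _ hx))
  have : Nonempty { s : Set L // IsClopen s ∧ a ∈ s } := ⟨⟨univ, isClopen_univ, mem_univ _⟩⟩
  obtain ⟨⟨s, hs, has⟩, hsU⟩ := exists_subset_nhds_of_isCompact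
    (V := fun s : { s : Set L // IsClopen s ∧ a ∈ s } => (s : Set L))
    (by
      rintro ⟨s, hs, has⟩ ⟨t, ht, hat⟩
      exact ⟨⟨s ∩ t, hs.inter ht, has, hat⟩, inter_subset_left, inter_subset_right⟩)
    (fun s => s.2.1.isClosed.isCompact) hV
  refine ⟨(↑) '' s, (↑) '' sᶜ, ⟨hL.isClosedMap_subtype_val _ hs.isClosed,
    hL.isClosedMap_subtype_val _ hs.compl.isClosed,
    (disjoint_image_iff Subtype.val_injective).2 disjoint_compl_right, ?_⟩,
    mem_image_of_mem _ has, image_subset_iff.2 hsU⟩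
  rw [← image_union, union_compl_self, image_univ, Subtype.range_coe]

/-- In a hereditarily indecomposable space, components of two closed sets are disjoint when neither
is contained in the intersection. -/
theorem IsHereditarilyIndecomposable.disjoint_components (hX : IsHereditarilyIndecomposable X)
    {L H : Set X} (hL : IsClosed L) (hH : IsClosed H) (a : L) (b : H) (ha : (a : X) ∉ H)
    (hb : (b : X) ∉ L) :
    Disjoint (((↑) : L → X) '' connectedComponent a) (((↑) : H → X) '' connectedComponent b) := by
  rw [disjoint_iff_inter_eq_empty, ← not_nonempty_iff_eq_empty]
  intro hne
  have hKL : ((↑) : L → X) '' connectedComponent a ⊆ L := by simp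
  have hMH : ((↑) : H → X) '' connectedComponent b ⊆ H := by simp
  have haK : (a : X) ∈ ((↑) : L → X) '' connectedComponent a :=
    mem_image_of_mem _ mem_connectedComponent
  have hbM : (b : X) ∈ ((↑) : H → X) '' connectedComponent b :=
    mem_image_of_mem _ mem_connectedComponent
  have hK : IsSubcontinuum (((↑) : L → X) '' connectedComponent a) :=
    ⟨hL.isClosedMap_subtype_val _ isClosed_connectedComponent,
      isConnected_connectedComponent.image _ continuous_subtype_val.continuousOn⟩
  have hM : IsSubcontinuum (((↑) : H → X) '' connectedComponent b) :=
    ⟨hH.isClosedMap_subtype_val _ isClosed_connectedComponent,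
      isConnected_connectedComponent.image _ continuous_subtype_val.continuousOn⟩
  -- If the components met, their union would be a subcontinuum, so one would contain the other,
  -- contradicting `ha` or `hb`.
  rcases hX _ ⟨hK.1.union hM.1, hK.2.union hne hM.2⟩ _ _ hK hM rfl with h | h
  · exact hb (hKL (h ▸ Or.inr hbM))
  · exact ha (hMH (h ▸ Or.inl haK))

/-- The Krasinkiewicz–Minc separation property, for clopen parts of two closed sets. -/
theorem IsHereditarilyIndecomposable.exists_disjoint_clopenSplit [CompactSpace X] [T2Space X]
    (hX : IsHereditarilyIndecomposable X) {L H A B : Set X} (hL : IsClosed L) (hH : IsClosed H)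
    (hA : IsClosed A) (hB : IsClosed B) (hAL : A ⊆ L) (hBH : B ⊆ H) (hAH : Disjoint A H)
    (hBL : Disjoint B L) :
    ∃ P P' Q Q', IsClopenSplit L P P' ∧ IsClopenSplit H Q Q' ∧ A ⊆ P ∧ B ⊆ Q ∧ Disjoint P Q := by
  have triv : ∀ {L : Set X}, IsClosed L → IsClopenSplit L ∅ L := fun hL =>
    ⟨isClosed_empty, hL, by simp, by simp⟩
  -- Compactness is used twice: with `b` fixed, over `A`, uniting the parts of `L` and intersecting
  -- those of `H`; then over `B`, with the roles exchanged.
  have hpoint : ∀ b ∈ B, ∃ P P' Q Q', IsClopenSplit L P P' ∧ IsClopenSplit H Q Q' ∧ A ⊆ P ∧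
      b ∈ Q ∧ Disjoint P Q := by
    intro b hb
    refine hA.isCompact.induction_on (p := fun S => ∃ P P' Q Q', IsClopenSplit L P P' ∧
      IsClopenSplit H Q Q' ∧ S ⊆ P ∧ b ∈ Q ∧ Disjoint P Q) ?_ ?_ ?_ ?_
    · exact ⟨∅, L, H, ∅, triv hL, (triv hH).symm, by simp, hBH hb, by simp⟩
    · rintro S T hST ⟨P, P', Q, Q', h1, h2, h3, h4⟩
      exact ⟨P, P', Q, Q', h1, h2, hST.trans h3, h4⟩
    · rintro S T ⟨P, P', Q, Q', h1, h2, h3, h4, h5⟩ ⟨R, R', O, O', k1, k2, k3, k4, k5⟩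
      refine ⟨P ∪ R, P' ∩ R', Q ∩ O, Q' ∪ O', h1.union_inter k1,
        (h2.symm.union_inter k2.symm).symm, union_subset_union h3 k3, ⟨h4, k4⟩, ?_⟩
      exact disjoint_union_left.2 ⟨h5.mono_right inter_subset_left,
        k5.mono_right inter_subset_right⟩
    · intro a ha
      have hdis := hX.disjoint_components hL hH ⟨a, hAL ha⟩ ⟨b, hBH hb⟩
        (disjoint_left.1 hAH ha) (disjoint_left.1 hBL hb)
      obtain ⟨U, V, hU, hV, hKU, hMV, hUV⟩ := SeparatedNhds.of_isCompact_isCompact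
        (hL.isClosedMap_subtype_val _ isClosed_connectedComponent).isCompact
        (hH.isClosedMap_subtype_val _ isClosed_connectedComponent).isCompact hdis
      obtain ⟨P, P', hP, haP, hPU⟩ := exists_clopenSplit_of_component hL _ hU hKU
      obtain ⟨Q, Q', hQ, hbQ, hQV⟩ := exists_clopenSplit_of_component hH _ hV hMV
      exact ⟨P, hP.mem_nhdsWithin hAL haP, P, P', Q, Q', hP, hQ, le_rfl, hbQ, hUV.mono hPU hQV⟩
  refine hB.isCompact.induction_on (p := fun S => ∃ P P' Q Q', IsClopenSplit L P P' ∧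
    IsClopenSplit H Q Q' ∧ A ⊆ P ∧ S ⊆ Q ∧ Disjoint P Q) ?_ ?_ ?_ ?_
  · exact ⟨L, ∅, ∅, H, (triv hL).symm, triv hH, hAL, by simp, by simp⟩
  · rintro S T hST ⟨P, P', Q, Q', h1, h2, h3, h4, h5⟩
    exact ⟨P, P', Q, Q', h1, h2, h3, hST.trans h4, h5⟩
  · rintro S T ⟨P, P', Q, Q', h1, h2, h3, h4, h5⟩ ⟨R, R', O, O', k1, k2, k3, k4, k5⟩
    refine ⟨P ∩ R, P' ∪ R', Q ∪ O, Q' ∩ O', (h1.symm.union_inter k1.symm).symm,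
      h2.union_inter k2, subset_inter h3 k3, union_subset_union h4 k4, ?_⟩
    exact disjoint_union_right.2 ⟨h5.mono_left inter_subset_left, k5.mono_left inter_subset_right⟩
  · intro b hb
    obtain ⟨P, P', Q, Q', h1, h2, h3, h4, h5⟩ := hpoint b hb
    exact ⟨Q, h2.mem_nhdsWithin hBH h4, P, P', Q, Q', h1, h2, h3, le_rfl, h5⟩

end Separation

/-! ### Folding a chain and splitting a link. -/

section Refinement

variable {X : Type*} [TopologicalSpace X] {M : ℕ} {a : ℕ → Set X}

/-- Folding a chain along a simple fold. -/
theorem IsNatChain.exists_simpleFold [CompactSpace X] [T2Space X] [ConnectedSpace X]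
    (hX : IsHereditarilyIndecomposable X) (h : IsNatChain M a) {p q : ℕ} (hpq : p < q)
    (hqM : q ≤ M) :
    ∃ b, IsNatChain (M + 2 * (q - p)) b ∧ ∀ x, b x ⊆ a (simpleFold p q x) := by
  obtain ⟨x₀, hx₀⟩ := (h.regularClosed 0).interior_nonempty (h.nonempty 0 (by omega))
  obtain ⟨y₀, hy₀⟩ := (h.regularClosed M).interior_nonempty (h.nonempty M le_rfl)
  have hxa := interior_subset hx₀
  have hya := interior_subset hy₀
  have hx₀' : ∀ i, 0 < i → x₀ ∉ a i := fun i hi =>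
    disjoint_left.1 (h.disjoint_interior hi.ne) hx₀
  have hy₀' : ∀ i, i < M → y₀ ∉ a i := fun i hi =>
    disjoint_left.1 (h.disjoint_interior hi.ne') hy₀
  have aL : ∀ {i}, i < q → a i ⊆ ⋃ i ∈ Iio q, a i := fun {i} hi => subset_biUnion_of_mem (u := a) hi
  have aH : ∀ {i}, p < i → a i ⊆ ⋃ i ∈ Ioi p, a i := fun {i} hi => subset_biUnion_of_mem (u := a) hi
  -- The points `x₀` and `y₀` matter when `p = 0` or `q = M`, where the unions in `A` or `B` are
  -- empty: they keep the two end links of the folded chain nonempty.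
  obtain ⟨L0, L1, H2, H1, hL, hH, hA, hB, hLH⟩ := hX.exists_disjoint_clopenSplit
    (L := ⋃ i ∈ Iio q, a i) (H := ⋃ i ∈ Ioi p, a i)
    (A := (⋃ i ∈ Iio p, a i) ∪ {x₀}) (B := (⋃ i ∈ Ioi q, a i) ∪ {y₀})
    (h.isClosed_biUnion _) (h.isClosed_biUnion _)
    ((h.isClosed_biUnion _).union isClosed_singleton)
    ((h.isClosed_biUnion _).union isClosed_singleton)
    (union_subset (biUnion_subset_biUnion_left (Iio_subset_Iio hpq.le))
      (singleton_subset_iff.2 (aL (by omega) hxa)))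
    (union_subset (biUnion_subset_biUnion_left (Ioi_subset_Ioi hpq.le))
      (singleton_subset_iff.2 (aH (by omega) hya)))
    (disjoint_union_left.2 ⟨h.disjoint_biUnion fun i hi j hj => by
        simp only [mem_Iio, mem_Ioi] at hi hj; omega, by
      simp only [disjoint_singleton_left, mem_iUnion, exists_prop, not_exists, not_and, mem_Ioi]
      exact fun i hi => hx₀' i (by omega)⟩)
    (disjoint_union_left.2 ⟨h.disjoint_biUnion fun i hi j hj => by
        simp only [mem_Iio, mem_Ioi] at hi hj; omega, by
      simp only [disjoint_singleton_left, mem_iUnion, exists_prop, not_exists, not_and, mem_Iio]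
      exact fun i hi => hy₀' i (by omega)⟩)
  have aA : ∀ {i}, i < p → a i ⊆ L0 := fun {i} hi =>
    (subset_biUnion_of_mem (u := a) (show i ∈ Iio p from hi)).trans (subset_union_left.trans hA)
  have aB : ∀ {i}, q < i → a i ⊆ H2 := fun {i} hi =>
    (subset_biUnion_of_mem (u := a) (show i ∈ Ioi q from hi)).trans (subset_union_left.trans hB)
  have hx₀L : x₀ ∈ L0 := hA (Or.inr rfl)
  have hy₀H : y₀ ∈ H2 := hB (Or.inr rfl)
  rw [← hL.union] at aL
  rw [← hH.union] at aH
  -- The rising legs live in `L0` and `H2`, the falling leg in `L1 ∩ H1`. At the turns only one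
  -- condition applies, since the links `a q` and `a p` need not lie in `L` and `H` respectively.
  -- `D` is the complementary part, which makes each new link regular closed.
  let C : ℕ → Set X := fun x =>
    if x < q then L0 else if x = q then H1 else if x < 2 * q - p then L1 ∩ H1
    else if x = 2 * q - p then L1 else H2
  let D : ℕ → Set X := fun x =>
    if x < q then L1 else if x = q then H2 else if x < 2 * q - p then L0 ∪ H2
    else if x = 2 * q - p then L0 else H1
  have hC : ∀ x, IsClosed (C x) := by
    intro x
    dsimp only [C]
    split_ifs
    exacts [hL.closed_left, hH.closed_right, hL.closed_right.inter hH.closed_right,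
      hL.closed_right, hH.closed_left]
  have hD : ∀ x, IsClosed (D x) := by
    intro x
    dsimp only [D]
    split_ifs
    exacts [hL.closed_right, hH.closed_left, hL.closed_left.union hH.closed_left,
      hL.closed_left, hH.closed_right]
  have hCD : ∀ x, Disjoint (C x) (D x) := by
    intro x
    dsimp only [C, D]
    split_ifs
    exacts [hL.disjoint, hH.disjoint.symm, disjoint_union_right.2
      ⟨hL.disjoint.symm.mono_left inter_subset_left, hH.disjoint.symm.mono_left inter_subset_right⟩,
      hL.disjoint.symm, hH.disjoint]
  have hcov : ∀ x, a (simpleFold p q x) ⊆ C x ∪ D x := by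
    intro x
    dsimp only [C, D, simpleFold]
    rcases lt_trichotomy x q with h1 | h1 | h1
    · rw [if_pos h1.le, if_pos h1, if_pos h1]
      exact aL h1
    · subst h1
      simp only [le_refl, if_true, lt_irrefl, if_false]
      rw [union_comm]
      exact aH hpq
    · rw [if_neg h1.not_ge, if_neg h1.not_gt, if_neg h1.ne', if_neg h1.not_gt, if_neg h1.ne']
      rcases lt_trichotomy x (2 * q - p) with h2 | h2 | h2
      · rw [if_pos h2.le, if_pos h2, if_pos h2]
        intro y hy
        have m1 := aL (i := 2 * q - x) (by omega) hy
        have m2 := aH (i := 2 * q - x) (by omega) hy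
        simp only [mem_union, mem_inter_iff] at *
        tauto
      · rw [if_pos h2.le, if_neg h2.not_lt, if_pos h2, if_neg h2.not_lt, if_pos h2, union_comm]
        exact aL (by omega)
      · rw [if_neg h2.not_ge, if_neg h2.not_gt, if_neg h2.ne', if_neg h2.not_gt, if_neg h2.ne']
        exact aH (by omega)
  -- Two indices on a common leg, turns included, have distinct images under the fold and inherit
  -- separation from `a`; indices on different legs are separated by `C`.
  have key : ∀ x y, x < y → Disjoint (C x) (C y) ∨
      (simpleFold p q x < simpleFold p q y ∧
        (x + 1 < y → simpleFold p q x + 1 < simpleFold p q y)) ∨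
      (simpleFold p q y < simpleFold p q x ∧
        (x + 1 < y → simpleFold p q y + 1 < simpleFold p q x)) := by
    intro x y hxy
    by_cases c1 : x < q ∧ q < y
    · by_cases c2 : y ≤ 2 * q - p
      · left
        simp only [C, if_pos c1.1, if_neg c1.2.not_gt, if_neg c1.2.ne']
        split_ifs
        · exact hL.disjoint.mono_right inter_subset_left
        · exact hL.disjoint
        · omega
      · left
        simp only [C, if_pos c1.1, if_neg c1.2.not_gt, if_neg c1.2.ne',
          if_neg (show ¬ y < 2 * q - p by omega), if_neg (show ¬ y = 2 * q - p by omega)]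
        exact hLH
    · by_cases c2 : q ≤ x ∧ x < 2 * q - p ∧ 2 * q - p < y
      · left
        simp only [C, if_neg c2.1.not_gt, if_pos c2.2.1,
          if_neg (show ¬ y < q by omega), if_neg (show ¬ y = q by omega),
          if_neg (show ¬ y < 2 * q - p by omega), if_neg (show ¬ y = 2 * q - p by omega)]
        split_ifs
        · exact hH.disjoint.symm
        · exact hH.disjoint.symm.mono_left inter_subset_right
      · right
        simp only [simpleFold]
        split_ifs <;> omega
  have hdis : ∀ x y, x + 1 < y → Disjoint (a (simpleFold p q x) ∩ C x)
      (a (simpleFold p q y) ∩ C y) := by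
    intro x y hxy
    rcases key x y (by omega) with h1 | ⟨-, h1⟩ | ⟨-, h1⟩
    · exact h1.mono inter_subset_right inter_subset_right
    · exact (h.disjoint _ _ (h1 hxy)).mono inter_subset_left inter_subset_left
    · exact (h.disjoint _ _ (h1 hxy)).symm.mono inter_subset_left inter_subset_left
  refine ⟨fun x => a (simpleFold p q x) ∩ C x, IsNatChain.of_ends (fun x => ?_) (fun z => ?_)
    (fun x y hxy => ?_) hdis (fun x hx => ?_) ⟨x₀, ?_, ?_⟩ ⟨y₀, ?_, ?_⟩,
    fun x => inter_subset_left⟩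
  · exact (h.regularClosed _).inter_of_disjoint (hC x) (hD x) (hcov x) (hCD x)
  · obtain ⟨i, hi⟩ := h.cover z
    have leg1 : i < q → z ∈ L0 → ∃ x, z ∈ a (simpleFold p q x) ∩ C x := fun h1 h2 =>
      ⟨i, by simpa [simpleFold, h1.le] using hi, by simpa [C, h1] using h2⟩
    have leg3 : p < i → z ∈ H2 → ∃ x, z ∈ a (simpleFold p q x) ∩ C x := fun h1 h2 => by
      refine ⟨i + 2 * (q - p), ?_, ?_⟩
      · rwa [simpleFold, if_neg (by omega), if_neg (by omega), Nat.add_sub_cancel]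
      · simp only [C]
        rwa [if_neg (by omega), if_neg (by omega), if_neg (by omega), if_neg (by omega)]
    rcases lt_or_ge i q with h1 | h1
    · rcases aL h1 hi with h2 | h2
      · exact leg1 h1 h2
      · rcases lt_trichotomy i p with h3 | h3 | h3
        · exact leg1 h1 (aA h3 hi)
        · refine ⟨2 * q - p, ?_, ?_⟩
          · rwa [simpleFold, if_neg (by omega), if_pos le_rfl,
              show 2 * q - (2 * q - p) = i by omega]
          · simp only [C]
            rwa [if_neg (by omega), if_neg (by omega), if_neg (by omega), if_pos trivial]
        · rcases aH h3 hi with h4 | h4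
          · exact leg3 h3 h4
          · refine ⟨2 * q - i, ?_, ?_⟩
            · rwa [simpleFold, if_neg (by omega), if_pos (by omega),
                show 2 * q - (2 * q - i) = i by omega]
            · simp only [C]
              rw [if_neg (by omega), if_neg (by omega), if_pos (by omega)]
              exact ⟨h2, h4⟩
    · rcases h1.eq_or_lt with rfl | h1
      · rcases aH hpq hi with h2 | h2
        · exact leg3 hpq h2
        · exact ⟨q, by simpa [simpleFold] using hi, by simpa [C] using h2⟩
      · exact leg3 (by omega) (aB h1 hi)
  · rw [← subset_empty_iff]
    rcases key x y hxy with h1 | ⟨h1, -⟩ | ⟨h1, -⟩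
    · rw [(h1.mono inter_subset_right inter_subset_right).inter_eq, interior_empty]
    · rw [← h.merelyTouch _ _ h1]
      exact interior_mono (inter_subset_inter inter_subset_left inter_subset_left)
    · rw [← h.merelyTouch _ _ h1, inter_comm (a _) (a _)]
      exact interior_mono (inter_subset_inter inter_subset_left inter_subset_left)
  · simp only [simpleFold]
    rw [if_neg (by omega), if_neg (by omega), h.eq_empty _ (by omega), empty_inter]
  · simpa [simpleFold] using hxa
  · simpa only [C, if_pos (show 0 < q by omega)] using hx₀L
  · rwa [simpleFold, if_neg (by omega), if_neg (by omega), Nat.add_sub_cancel]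
  · simp only [C]
    rwa [if_neg (by omega), if_neg (by omega), if_neg (by omega), if_neg (by omega)]

/-- Splitting the link `j` of a chain into two consecutive links. -/
theorem IsNatChain.exists_split [NormalSpace X] [T1Space X] [ConnectedSpace X] [Nontrivial X]
    (h : IsNatChain M a) {j : ℕ} (hj : j ≤ M) :
    ∃ b, IsNatChain (M + 1) b ∧ ∀ x, b x ⊆ a (if x ≤ j then x else x - 1) := by
  obtain ⟨x₀, hx₀⟩ := (h.regularClosed j).interior_nonempty (h.nonempty j hj)
  -- A nontrivial connected T1 space has no isolated points, so there is room for one witness in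
  -- each half of the link.
  have hinf : (interior (a j)).Infinite := infinite_of_mem_nhds x₀ (isOpen_interior.mem_nhds hx₀)
  obtain ⟨y₀, hy₀, hxy₀⟩ := hinf.nontrivial.exists_ne x₀
  have hnot : ∀ z ∈ interior (a j), ∀ i, i ≠ j → z ∉ a i := fun z hz i hi =>
    disjoint_left.1 (h.disjoint_interior hi.symm) hz
  have hPQ : Disjoint ((⋃ i ∈ Iio j, a i) ∪ {x₀}) ((⋃ i ∈ Ioi j, a i) ∪ {y₀}) := by
    refine disjoint_union_left.2 ⟨disjoint_union_right.2 ⟨h.disjoint_biUnion fun i hi k hk => ?_, ?_⟩,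
      disjoint_union_right.2 ⟨?_, ?_⟩⟩
    · simp only [mem_Iio, mem_Ioi] at hi hk
      omega
    · simp only [disjoint_singleton_right, mem_iUnion, exists_prop, not_exists, not_and, mem_Iio]
      exact fun i hi => hnot _ hy₀ i (by omega)
    · simp only [disjoint_singleton_left, mem_iUnion, exists_prop, not_exists, not_and, mem_Ioi]
      exact fun i hi => hnot _ hx₀ i (by omega)
    · simpa using hxy₀.symm
  -- The boundary of `V` cuts the link: the half outside `closure V` avoids all later links, the
  -- half in `closure V` avoids all earlier ones.
  obtain ⟨V, hV, hQV, hVP⟩ := normal_exists_closure_subset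
    ((h.isClosed_biUnion (Ioi j)).union (isClosed_singleton (x := y₀)))
    ((h.isClosed_biUnion (Iio j)).union (isClosed_singleton (x := x₀))).isOpen_compl
    (subset_compl_iff_disjoint_left.2 hPQ)
  have hP : ∀ i < j, Disjoint (a i) (closure V) := fun i hi =>
    (subset_compl_iff_disjoint_left.1 hVP).mono_left
      ((subset_biUnion_of_mem (u := a) (show i ∈ Iio j from hi)).trans subset_union_left)
  have hQ : ∀ i, j < i → a i ⊆ V := fun i hi =>
    ((subset_biUnion_of_mem (u := a) (show i ∈ Ioi j from hi)).trans subset_union_left).trans hQV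
  have hx₀V : x₀ ∉ closure V := fun h' => hVP h' (Or.inr rfl)
  have hy₀V : y₀ ∈ V := hQV (Or.inr rfl)
  set c := closure (interior (a j) ∩ (closure V)ᶜ) with hc
  set d := closure (interior (a j) ∩ V) with hd
  have hca : c ⊆ a j := closure_minimal (inter_subset_left.trans interior_subset)
    (h.regularClosed j).isClosed
  have hda : d ⊆ a j := closure_minimal (inter_subset_left.trans interior_subset)
    (h.regularClosed j).isClosed
  have hcV : Disjoint V c := by
    refine Disjoint.closure_right ?_ hV
    exact disjoint_compl_right.mono subset_closure inter_subset_right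
  have hdV : d ⊆ closure V := closure_mono inter_subset_right
  have hcd : a j ⊆ c ∪ d := by
    conv_lhs => rw [← h.regularClosed j]
    refine closure_minimal (fun z hz => ?_) (isClosed_closure.union isClosed_closure)
    by_cases hzV : z ∈ closure V
    · exact Or.inr (isOpen_interior.inter_closure ⟨hz, hzV⟩)
    · exact Or.inl (subset_closure ⟨hz, hzV⟩)
  have hint : interior (c ∩ d) = ∅ := by
    rw [← subset_empty_iff]
    intro z hz
    have hz2 : z ∈ closure V := hdV (interior_subset hz).2
    obtain ⟨w, hw, hwV⟩ := mem_closure_iff.1 hz2 _ isOpen_interior hz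
    exact disjoint_left.1 hcV hwV (interior_subset hw).1
  let b : ℕ → Set X := fun x => if x < j then a x else if x = j then c else
    if x = j + 1 then d else a (x - 1)
  have b1 : ∀ {x}, x < j → b x = a x := fun {x} hx => by simp [b, hx]
  have b2 : b j = c := by simp [b]
  have b3 : b (j + 1) = d := by simp [b]
  have b4 : ∀ {x}, j + 1 < x → b x = a (x - 1) := fun {x} hx => by
    simp only [b]; rw [if_neg (by omega), if_neg (by omega), if_neg (by omega)]
  have cases : ∀ x, x < j ∨ x = j ∨ x = j + 1 ∨ j + 1 < x := fun x => by omega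
  have hba : ∀ x, b x ⊆ a (if x ≤ j then x else x - 1) := by
    intro x
    rcases cases x with hx | rfl | rfl | hx
    · rw [b1 hx, if_pos hx.le]
    · rw [b2, if_pos le_rfl]; exact hca
    · rw [b3, if_neg (by omega)]; exact hda
    · rw [b4 hx, if_neg (by omega)]
  refine ⟨b, ⟨fun x => ?_, fun z => ?_, fun x y hxy => ?_, fun x y hxy => ?_, fun x hx => ?_,
    fun x hx => ?_⟩, hba⟩
  · rcases cases x with hx | rfl | rfl | hx
    · rw [b1 hx]; exact h.regularClosed _
    · rw [b2]
      exact isRegularClosed_closure_of_isOpen (isOpen_interior.inter isClosed_closure.isOpen_compl)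
    · rw [b3]
      exact isRegularClosed_closure_of_isOpen (isOpen_interior.inter hV)
    · rw [b4 hx]; exact h.regularClosed _
  · obtain ⟨i, hi⟩ := h.cover z
    rcases lt_trichotomy i j with hij | rfl | hij
    · exact ⟨i, by rwa [b1 hij]⟩
    · rcases hcd hi with h' | h'
      · exact ⟨i, by rwa [b2]⟩
      · exact ⟨i + 1, by rwa [b3]⟩
    · exact ⟨i + 1, by rwa [b4 (by omega)]⟩
  · by_cases hj' : x = j ∧ y = j + 1
    · rw [hj'.1, hj'.2, b2, b3, hint]
    · rw [← subset_empty_iff, ← h.merelyTouch (if x ≤ j then x else x - 1)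
        (if y ≤ j then y else y - 1) (by split_ifs <;> omega)]
      exact interior_mono (inter_subset_inter (hba x) (hba y))
  · by_cases h1 : x < j ∧ y = j + 1
    · rw [h1.2, b1 h1.1, b3]
      exact (hP x h1.1).mono_right hdV
    by_cases h2 : x = j ∧ j + 1 < y
    · rw [h2.1, b2, b4 h2.2]
      exact hcV.symm.mono_right (hQ _ (by omega))
    exact (h.disjoint _ _ (by split_ifs <;> omega)).mono (hba x) (hba y)
  · rw [b4 (by omega)]
    exact h.eq_empty _ (by omega)
  · rcases cases x with hx' | rfl | rfl | hx'
    · rw [b1 hx']; exact h.nonempty _ (by omega)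
    · rw [b2]; exact ⟨x₀, subset_closure ⟨hx₀, hx₀V⟩⟩
    · rw [b3]; exact ⟨y₀, subset_closure ⟨hy₀, hy₀V⟩⟩
    · rw [b4 hx']; exact h.nonempty _ (by omega)

end Refinement
-- Following an arbitrary walk, and transfer to the finite tuples.
section Following

variable {X : Type*} [TopologicalSpace X] {N : ℕ} {a : ℕ → Set X}

/-- In a hereditarily indecomposable continuum every surjective walk on the links of a chain is
followed by some chain. -/
theorem IsNatChain.exists_follows [CompactSpace X] [T2Space X] [ConnectedSpace X] [Nontrivial X]
    (hX : IsHereditarilyIndecomposable X) (ha : IsNatChain N a) (M : ℕ) :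
    ∀ F : ℕ → ℕ, IsShortStep M F → (∀ k ≤ M, F k ≤ N) → (∀ i ≤ N, ∃ k ≤ M, F k = i) →
      ∃ b, IsNatChain M b ∧ ∀ k ≤ M, b k ⊆ a (F k) := by
  induction M using Nat.strong_induction_on with
  | _ M ih =>
  intro F hF hN hsurj
  by_cases hstall : ∃ j, j < M ∧ F j = F (j + 1)
  · obtain ⟨j, hj, hFj⟩ := hstall
    obtain ⟨b', hb', hb'F⟩ := ih (M - 1) (by omega) (fun k => if k ≤ j then F k else F (k + 1))
      (fun k hk => by
        have h1 := hF k (by omega)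
        have h2 := hF (k + 1) (by omega)
        by_cases hkj : k < j
        · simpa only [if_pos hkj.le, if_pos (show k + 1 ≤ j from hkj)] using h1
        · rcases eq_or_ne k j with rfl | hne
          · simpa only [le_refl, if_true, if_neg (show ¬ k + 1 ≤ k by omega), hFj] using h2
          · simpa only [if_neg (show ¬ k ≤ j by omega), if_neg (show ¬ k + 1 ≤ j by omega)]
              using h2)
      (fun k hk => by split_ifs <;> exact hN _ (by omega))
      (fun i hi => by
        obtain ⟨k, hk, rfl⟩ := hsurj i hi
        rcases le_or_gt k j with hkj | hkj
        · exact ⟨k, by omega, if_pos hkj⟩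
        · rcases eq_or_ne k (j + 1) with rfl | hne
          · exact ⟨j, by omega, by simpa using hFj⟩
          · refine ⟨k - 1, by omega, ?_⟩
            rw [if_neg (by omega), Nat.sub_add_cancel (by omega)])
    obtain ⟨b, hb, hbb'⟩ := hb'.exists_split (j := j) (by omega)
    rw [Nat.sub_add_cancel (by omega)] at hb
    refine ⟨b, hb, fun k hk => (hbb' k).trans ?_⟩
    rcases le_or_gt k j with hkj | hkj
    · rw [if_pos hkj]
      exact (hb'F k (by omega)).trans (by rw [if_pos hkj])
    · rw [if_neg hkj.not_ge]
      refine (hb'F (k - 1) (by omega)).trans ?_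
      rcases eq_or_ne k (j + 1) with rfl | hne
      · simp [hFj]
      · rw [if_neg (by omega), Nat.sub_add_cancel (by omega)]
  have hs : ∀ k < M, F k ≠ F (k + 1) := fun k hk h => hstall ⟨k, hk, h⟩
  by_cases hturn : ∃ u, 0 < u ∧ u < M ∧ F (u - 1) = F (u + 1)
  · obtain ⟨s, l, hl, hlM, hsl, hleft, hright⟩ := exists_shortest_run hF hs hturn
    rcases Nat.eq_zero_or_pos s with rfl | hs0
    · -- the run starts at the left end
      obtain ⟨hlM', href⟩ := hright (by omega)
      simp only [zero_add] at hlM' href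
      -- Dropping the first run loses no values, since the walk retraces it after the turn at `l`.
      obtain ⟨b', hb', hb'F⟩ := ih (M - l) (by omega) (fun k => F (k + l))
        (fun k hk => by
          have := hF (k + l) (by omega)
          rwa [show k + l + 1 = k + 1 + l by omega] at this)
        (fun k hk => hN _ (by omega))
        (fun i hi => by
          obtain ⟨k, hk, rfl⟩ := hsurj i hi
          rcases le_total k l with hkl | hkl
          · refine ⟨l - k, by omega, ?_⟩
            have := href (l - k) (by omega)
            rw [show l - (l - k) = k by omega] at this
            rw [← this, add_comm]
          · exact ⟨k - l, by omega, by simp only [Nat.sub_add_cancel hkl]⟩)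
      obtain ⟨c, hc, hcb⟩ := hb'.exists_simpleFold hX (p := 0) (q := l) hl (by omega)
      -- The fold has `l` steps too many; `g` merges link `x` of the first leg with link `2 * l - x`
      -- of the second, and both lie in the same link of `b'`.
      refine ⟨_, hc.amalgamate (K := M) (g := fun x => if x ≤ l then l - x else x - l)
        (fun k hk => by dsimp only; split_ifs <;> omega)
        (fun i hi => by split_ifs <;> omega)
        (fun k hk => ?_), fun k hk => iUnion₂_subset fun i hi => ?_⟩
      · refine ⟨k + l, by omega, ?_⟩
        split_ifs <;> omega
      · intro x hx
        have hiM := hc.le_of_mem hx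
        have hx' := hcb i hx
        have hx'' := hb'F _ (hb'.le_of_mem hx') hx'
        simp only [mem_preimage, mem_singleton_iff] at hi
        convert hx'' using 2
        subst hi
        simp only [simpleFold]
        by_cases h1 : i ≤ l
        · rw [if_pos h1, if_pos h1, ← href i h1, add_comm]
        · rw [if_neg h1, if_neg h1]
          split_ifs with h2
          · have := href (2 * l - i) (by omega)
            rw [show l - (2 * l - i) = i - l by omega] at this
            rw [← this, add_comm]
          · congr 1
            omega
    obtain ⟨hls, href⟩ := hleft hs0
    rcases hsl.lt_or_eq with hslM | rfl
    · obtain ⟨hlM', href'⟩ := hright hslM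
      have hper : ∀ k ≤ l, F (s - l + k) = F (s + l + k) := by
        intro k hk
        have h1 := href (l - k) (by omega)
        have h2 := href' k hk
        rw [show s - (l - k) = s - l + k by omega] at h1
        rw [show s + l - k = s + (l - k) by omega] at h2
        rw [h2, h1]
      -- `G` cuts `2 * l` steps out of `F`; the two descriptions agree on `{s - l, …, s}` because
      -- the two reflections compose to a translation by `2 * l`.
      obtain ⟨G, hG, hG'⟩ : ∃ G : ℕ → ℕ, (∀ x ≤ s, G x = F x) ∧
          ∀ x, s - l ≤ x → G x = F (x + 2 * l) := by
        refine ⟨fun x => if x ≤ s then F x else F (x + 2 * l), fun x hx => if_pos hx, fun x hx => ?_⟩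
        dsimp only
        split_ifs with h
        · have := hper (x - (s - l)) (by omega)
          rwa [show s - l + (x - (s - l)) = x by omega,
            show s + l + (x - (s - l)) = x + 2 * l by omega] at this
        · rfl
      have hfold : ∀ x, x ≤ M → G (simpleFold (s - l) s x) = F x := by
        intro x hx
        simp only [simpleFold]
        by_cases h1 : x ≤ s
        · rw [if_pos h1, hG x h1]
        · rw [if_neg h1]
          by_cases h2 : x ≤ 2 * s - (s - l)
          · rw [if_pos h2, hG _ (by omega)]
            have := href (x - s) (by omega)
            rw [show s + (x - s) = x by omega, show s - (x - s) = 2 * s - x by omega] at this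
            exact this.symm
          · rw [if_neg h2, hG' _ (by omega)]
            congr 1
            omega
      obtain ⟨b', hb', hb'F⟩ := ih (M - 2 * l) (by omega) G
        (fun k hk => by
          by_cases h1 : k < s
          · rw [hG k h1.le, hG (k + 1) h1]
            exact hF k (by omega)
          · rw [hG' k (by omega), hG' (k + 1) (by omega),
              show k + 1 + 2 * l = k + 2 * l + 1 by omega]
            exact hF _ (by omega))
        (fun k hk => by
          rcases le_or_gt k s with h | h
          · exact (hG k h).trans_le (hN _ (by omega))
          · exact (hG' k (by omega)).trans_le (hN _ (by omega)))
        (fun i hi => by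
          obtain ⟨k, hk, rfl⟩ := hsurj i hi
          refine ⟨_, ?_, hfold k hk⟩
          simp only [simpleFold]
          split_ifs <;> omega)
      obtain ⟨b, hb, hbb'⟩ := hb'.exists_simpleFold hX (p := s - l) (q := s) (by omega) (by omega)
      rw [show M - 2 * l + 2 * (s - (s - l)) = M by omega] at hb
      refine ⟨b, hb, fun k hk x hx => ?_⟩
      have hx' := hbb' k hx
      have hx'' := hb'F _ (hb'.le_of_mem hx') hx'
      rwa [hfold k hk] at hx''
    · -- the run ends at the right end
      obtain ⟨b', hb', hb'F⟩ := ih s (by omega) F (fun k hk => hF k (by omega))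
        (fun k hk => hN k (by omega))
        (fun i hi => by
          obtain ⟨k, hk, rfl⟩ := hsurj i hi
          rcases le_total k s with hks | hks
          · exact ⟨k, hks, rfl⟩
          · refine ⟨s - (k - s), by omega, ?_⟩
            rw [← href (k - s) (by omega)]
            congr 1
            omega)
      obtain ⟨c, hc, hcb⟩ := hb'.exists_simpleFold hX (p := s - l) (q := s) (by omega) le_rfl
      -- Mirror image of the left-end case: here the third leg is merged back onto the second.
      refine ⟨_, hc.amalgamate (K := s + l)
        (g := fun x => if x ≤ s + l then x else 2 * (s + l) - x)
        (fun k hk => by dsimp only; split_ifs <;> omega)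
        (fun i hi => by split_ifs <;> omega)
        (fun k hk => ⟨k, by omega, if_pos hk⟩), fun k hk => iUnion₂_subset fun i hi => ?_⟩
      intro x hx
      have hiM := hc.le_of_mem hx
      have hx' := hcb i hx
      have hx'' := hb'F _ (hb'.le_of_mem hx') hx'
      simp only [mem_preimage, mem_singleton_iff] at hi
      convert hx'' using 2
      subst hi
      simp only [simpleFold]
      by_cases h1 : i ≤ s
      · rw [if_pos h1, if_pos (by omega)]
      · rw [if_neg h1]
        by_cases h2 : i ≤ s + l
        · rw [if_pos h2, if_pos (by omega)]
          have := href (i - s) (by omega)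
          rwa [show s + (i - s) = i by omega, show s - (i - s) = 2 * s - i by omega] at this
        · rw [if_neg h2, if_neg (by omega)]
          have := href (s + 2 * l - i) (by omega)
          rwa [show s + (s + 2 * l - i) = 2 * (s + l) - i by omega,
            show s - (s + 2 * l - i) = i - 2 * (s - (s - l)) by omega] at this
  · have hno : ∀ u, 0 < u → u < M → F (u - 1) ≠ F (u + 1) := fun u h1 h2 h3 =>
      hturn ⟨u, h1, h2, h3⟩
    have hM := hN M le_rfl
    have h0 := hN 0 (by omega)
    obtain ⟨k₀, hk₀, hF0⟩ := hsurj 0 (by omega)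
    obtain ⟨k₁, hk₁, hF1⟩ := hsurj N le_rfl
    rcases linear_of_no_turning hF hs hno with hlin | hlin
    · have e0 := hlin k₀ hk₀
      have e1 := hlin k₁ hk₁
      have e2 := hlin M le_rfl
      obtain rfl : M = N := by omega
      exact ⟨a, ha, fun k hk => by rw [hlin k hk, show F 0 = 0 by omega, zero_add]⟩
    · have e0 := hlin k₀ hk₀
      have e1 := hlin k₁ hk₁
      have e2 := hlin M le_rfl
      obtain rfl : M = N := by omega
      refine ⟨_, ha.reverse, fun k hk => ?_⟩
      have := hlin k hk
      rw [if_pos hk, show F k = M - k by omega]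

/-- A chain of links, extended by empty sets. -/
theorem IsLinkChain.isNatChain [ConnectedSpace X] {N : ℕ} {a : Fin (N + 1) → Set X}
    (ha : IsLinkChain a) :
    IsNatChain N fun i => if h : i < N + 1 then a ⟨i, h⟩ else ∅ := by
  have hcov : ∀ x, ∃ i, x ∈ a i := fun x => mem_iUnion.1 (ha.good.cover ▸ mem_univ x)
  refine ⟨fun i => ?_, fun x => ?_, fun i j hij => ?_, fun i j hij => ?_, fun i hi => ?_,
    fun i hi => ?_⟩
  · split_ifs
    · exact ha.good.regularClosed _
    · simp [IsRegularClosed]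
  · obtain ⟨i, hi⟩ := hcov x
    exact ⟨i, by simpa [i.2] using hi⟩
  · by_cases hj : j < N + 1
    · rw [dif_pos hj, dif_pos (by omega)]
      refine closure_empty_iff _ |>.1 (ha.good.merelyTouch _ _ fun h => ?_)
      have := congrArg Fin.val (ha.good.nonrepeating h)
      simp only at this
      omega
    · simp [hj]
  · by_cases hj : j < N + 1
    · rw [dif_pos hj, dif_pos (by omega)]
      rw [disjoint_iff_inter_eq_empty, ← not_nonempty_iff_eq_empty]
      intro h
      have := abs_le.1 (ha.chain _ _ h)
      simp only at this
      omega
    · simp [hj]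
  · rw [dif_neg (by omega)]
  · rw [dif_pos (by omega), nonempty_iff_ne_empty]
    -- An empty link would be contained in every link, so minimality would make a link containing
    -- `x` empty.
    intro h
    obtain ⟨x⟩ := (inferInstance : Nonempty X)
    obtain ⟨j, hj⟩ := hcov x
    rw [← ha.good.minimal _ j (h ▸ empty_subset _), h] at hj
    exact hj

theorem IsNatChain.isLinkChain {M : ℕ} {b : ℕ → Set X} (hb : IsNatChain M b) :
    IsLinkChain fun i : Fin (M + 1) => b i := by
  -- Interior points of a nonempty link lie in no other link; this gives both injectivity and
  -- minimality.
  have hnot : ∀ i j : Fin (M + 1), b i ⊆ b j → i = j := by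
    intro i j hij
    by_contra hne
    obtain ⟨x, hx⟩ := (hb.regularClosed i).interior_nonempty (hb.nonempty i (by omega))
    exact disjoint_left.1 (hb.disjoint_interior (i := i) (j := j) fun h => hne (Fin.ext h)) hx
      (hij (interior_subset hx))
  refine ⟨⟨fun i j h => hnot i j h.subset, fun i => hb.regularClosed _, ?_, fun i j hij => ?_,
    fun i j hij => by rw [hnot i j hij]⟩, fun i j hij => ?_⟩
  · refine eq_univ_of_forall fun x => ?_
    obtain ⟨i, hi⟩ := hb.cover x
    exact mem_iUnion.2 ⟨⟨i, by have := hb.le_of_mem hi; omega⟩, hi⟩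
  · have hne : (i : ℕ) ≠ j := fun h => hij (by rw [h])
    rw [regMeet, closure_empty_iff]
    rcases lt_or_gt_of_ne hne with h | h
    · exact hb.merelyTouch _ _ h
    · rw [inter_comm]
      exact hb.merelyTouch _ _ h
  · obtain ⟨x, hxi, hxj⟩ := hij
    by_contra hgt
    rw [abs_le] at hgt
    rcases lt_or_ge (i : ℕ) j with h | h
    · exact disjoint_left.1 (hb.disjoint i j (by omega)) hxi hxj
    · exact disjoint_left.1 (hb.disjoint j i (by omega)) hxj hxi

end Following
end PseudoArcCologic

theorem mainTheorem7 {X : Type*} [TopologicalSpace X] (hX : PseudoArcCologic.IsPseudoArc X)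
    {m n : ℕ} (a : Fin n → Set X) (ha : PseudoArcCologic.IsLinkChain a)
    (f : Fin m → Fin n) (hf : PseudoArcCologic.IsPattern f) :
    ∃ b : Fin m → Set X, PseudoArcCologic.IsLinkChain b ∧ PseudoArcCologic.Follows b f a := by
  have := hX.compact
  have := hX.metrizable
  have := hX.connected
  have := hX.nondegenerate
  obtain ⟨x⟩ := (inferInstance : Nonempty X)
  obtain ⟨i₀, -⟩ := mem_iUnion.1 (ha.good.cover ▸ mem_univ x)
  obtain ⟨k₀, -⟩ := hf.surjective i₀
  obtain ⟨N, rfl⟩ : ∃ N, n = N + 1 := ⟨n - 1, by have := i₀.2; omega⟩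
  obtain ⟨M, rfl⟩ : ∃ M, m = M + 1 := ⟨m - 1, by have := k₀.2; omega⟩
  obtain ⟨b, hb, hba⟩ := ha.isNatChain.exists_follows hX.hereditarilyIndecomposable M
    -- The default `0` is harmless: the walk is only consulted at `k ≤ M`.
    (fun k => if h : k < M + 1 then f ⟨k, h⟩ else 0)
    (fun k hk => by
      have := abs_le.1 (hf.step ⟨k + 1, by omega⟩ ⟨k, by omega⟩ (by simp))
      dsimp only
      rw [dif_pos (by omega), dif_pos (by omega)]
      omega)
    (fun k hk => by
      rw [dif_pos (by omega)]
      omega)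
    (fun i hi => by
      obtain ⟨k, hk⟩ := hf.surjective ⟨i, by omega⟩
      exact ⟨k, by omega, by simp [k.2, hk]⟩)
  refine ⟨_, hb.isLinkChain, fun j => (hba j (by omega)).trans ?_⟩
  simp [Fin.is_le]
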